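/- Let $M$ be a (finite-dimensional, Hausdorff, boundaryless) smooth manifold. Equip $TM\oplus T^*M$ with the neutral metric $\langle X+\alpha,Y+\beta\rangle=\tfrac12(\beta(X)+\alpha(Y))$ and the Courant bracket $$[[X+\alpha,Y+\beta]]=[X,Y]+\mathcal L_X\beta-\mathcal L_Y\alpha-\tfrac12 d(\iota_X\beta-\iota_Y\alpha),$$ extended complex-bilinearly to $(TM\oplus T^*M)\otimes\mathbb C$. Let $(\Phi,E_+,E_-)$ be a generalized almost contact structure on $M$: $\Phi$ is a smooth endomorphism of $TM\oplus T^*M$ and $E_\pm$ are smooth sections of $TM\oplus T^*M$ with $$\Phi+\Phi^*=0,\qquad \Phi^2=-\mathrm{Id}+E_+\otimes E_-+E_-\otimes E_+,\qquad \langle E_\pm,E_\pm\rangle=0,\qquad 2\langle E_+,E_-\rangle=1,$$ where $(A\otimes B)(C)=2\langle B,C\rangle A$. Suppose that the restriction of $\Phi$ to $(E_+\oplus E_-)^\perp$ is a generalized complex structure, i.e. that it preserves $(E_+\oplus E_-)^\perp$, is skew for $\langle\cdot,\cdot\rangle$, squares to $-\mathrm{Id}$, and has an involutive $\sqrt{-1}$-eigenbundle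 $E^{(1,0)}\subset (E_+\oplus E_-)^\perp\otimes\mathbb C$ (its smooth sections are closed under the Courant bracket). Let $\pi_0$ be its canonical Poisson bivector, given by the $T^*M\to TM$ block of $\Phi$, $\pi_0(\alpha,\beta)=\beta(\mathrm{pr}_{TM}\Phi(\alpha))$, and let $e_\pm=\mathrm{pr}_{TM}(E_\pm)$. If $[[E_+,E_-]]=0$, then $$\pi_M=\pi_0+e_+\wedge e_-,\qquad (e_+\wedge e_-)(\alpha,\beta)=\alpha(e_+)\beta(e_-)-\alpha(e_-)\beta(e_+),$$ is a Poisson structure on $M$: a smooth bivector field such that $\{f,g\}=\pi_M(df,dg)$ satisfies the Jacobi identity on $C^\infty(M)$ (equivalently, $[\pi_M,\pi_M]=0$). -/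

import Mathlib

open scoped Manifold ContDiff Bundle

noncomputable section

namespace GenGeom

universe u v

variable (E : Type u) [NormedAddCommGroup E] [NormedSpace ℝ E]
  {M : Type v} [TopologicalSpace M] [ChartedSpace E M]

/-- The tangent space `T_x M`. -/
abbrev T (x : M) : Type u := TangentSpace 𝓘(ℝ, E) x

/-- The cotangent space `T*_x M`. -/
abbrev TStar (x : M) : Type u := T E x →L[ℝ] ℝ

/-- The fibre `T_x M ⊕ T*_x M` of the big tangent bundle; `(X, α)` stands for `X + α`. -/
abbrev GT (x : M) : Type u := T E x × TStar E x

/-- The neutral metric `⟨X + α, Y + β⟩ = (β(X) + α(Y)) / 2`. -/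
def pairing {x : M} (A B : GT E x) : ℝ := (B.2 A.1 + A.2 B.1) / 2

/-- Smoothness of a vector field. -/
def SmoothVec [IsManifold 𝓘(ℝ, E) ∞ M] (X : Π x : M, T E x) : Prop :=
  ContMDiff 𝓘(ℝ, E) (𝓘(ℝ, E).prod 𝓘(ℝ, E)) ∞
    (fun x => (Bundle.TotalSpace.mk' E x (X x) : TangentBundle 𝓘(ℝ, E) M))

/-- Smoothness of a 1-form, as a section of the bundle `Hom(TM, ℝ)`. -/
def SmoothForm [IsManifold 𝓘(ℝ, E) ∞ M] (α : Π x : M, TStar E x) : Prop :=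
  ContMDiff 𝓘(ℝ, E) (𝓘(ℝ, E).prod 𝓘(ℝ, E →L[ℝ] ℝ)) ∞
    (fun x => Bundle.TotalSpace.mk' (E →L[ℝ] ℝ)
      (E := fun y : M => TangentSpace 𝓘(ℝ, E) y →L[ℝ] Bundle.Trivial M ℝ y) x (α x))

/-- Smoothness of a real-valued function. -/
abbrev SmoothFun (f : M → ℝ) : Prop := ContMDiff 𝓘(ℝ, E) 𝓘(ℝ, ℝ) ∞ f

/-- The differential `df` of a function. -/
abbrev dd (f : M → ℝ) (x : M) : TStar E x := mvfderiv 𝓘(ℝ, E) f x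

variable (M)

/-- A smooth section `X + α` of `TM ⊕ T*M`. -/
structure GSection [IsManifold 𝓘(ℝ, E) ∞ M] where
  vec : Π x : M, T E x
  form : Π x : M, TStar E x
  smooth_vec : SmoothVec E vec
  smooth_form : SmoothForm E form

variable {M} {E}

/-- The value of a section at a point. -/
def GSection.val [IsManifold 𝓘(ℝ, E) ∞ M] (A : GSection E M) (x : M) : GT E x :=
  (A.vec x, A.form x)

section Courant

variable [IsManifold 𝓘(ℝ, E) ∞ M]

/-- `Z ↦ (X(β(Z)) - β([X, Z]))(x)` on vector fields `Z`. -/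
def lieFormAux (X : Π x : M, T E x) (β : Π x : M, TStar E x) (x : M)
    (Z : Π x : M, T E x) : ℝ :=
  dd E (fun y => β y (Z y)) x (X x) - β x (VectorField.mlieBracket 𝓘(ℝ, E) X Z x)

theorem mdiff_form_apply {β : Π x : M, TStar E x} (hβ : SmoothForm E β) {Z : Π x : M, T E x}
    {x : M} (hZ : MDifferentiableAt 𝓘(ℝ, E) (𝓘(ℝ, E).prod 𝓘(ℝ, E))
      (fun x => (Bundle.TotalSpace.mk' E x (Z x) : TangentBundle 𝓘(ℝ, E) M)) x) :
    MDifferentiableAt 𝓘(ℝ, E) 𝓘(ℝ, ℝ) (fun y => β y (Z y)) x := by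
  have : IsManifold 𝓘(ℝ, E) 1 M := IsManifold.of_le (n := ∞) (by simp)
  have h := MDifferentiableAt.clm_bundle_apply (𝕜 := ℝ) (F₁ := E) (F₂ := ℝ)
    (E₂ := Bundle.Trivial M ℝ) (b := fun y : M => y)
    ((hβ x).mdifferentiableAt (by simp)) hZ
  simp only [mdifferentiableAt_totalSpace] at h
  exact h.2

theorem lieFormAux_tensorial [FiniteDimensional ℝ E]
    (X : Π x : M, T E x) {β : Π x : M, TStar E x} (hβ : SmoothForm E β) (x : M) :
    TensorialAt 𝓘(ℝ, E) E (lieFormAux X β x) x := by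
  have : IsManifold 𝓘(ℝ, E) 1 M := IsManifold.of_le (n := ∞) (by simp)
  have : CompleteSpace E := FiniteDimensional.complete ℝ E
  constructor
  · intro f Z hf hZ
    have h1 := mdiff_form_apply hβ hZ
    have e : (fun y => β y ((f • Z) y)) = f * (fun y => β y (Z y)) := by
      ext y; simp
    simp only [lieFormAux, dd]
    rw [e, mvfderiv_mul hf h1, VectorField.mlieBracket_smul_right hf hZ]
    simp
    ring
  · intro Z W hZ hW
    have h1 := mdiff_form_apply hβ hZ
    have h2 := mdiff_form_apply hβ hW
    have e : (fun y => β y ((Z + W) y)) = (fun y => β y (Z y)) + (fun y => β y (W y)) := by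
      ext y; simp
    simp only [lieFormAux, dd]
    rw [e, mvfderiv_add h1 h2, VectorField.mlieBracket_add_right hZ hW]
    simp
    ring

/-- The Lie derivative `L_X β` of a smooth 1-form: the 1-form with
`(L_X β)(Z) = X(β(Z)) - β([X, Z])` for vector fields `Z`. -/
def lieForm [FiniteDimensional ℝ E] (X : Π x : M, T E x) (β : Π x : M, TStar E x)
    (hβ : SmoothForm E β) (x : M) : TStar E x :=
  haveI : IsManifold 𝓘(ℝ, E) 1 M := IsManifold.of_le (n := ∞) (by simp)
  TensorialAt.mkHom (lieFormAux X β x) x (lieFormAux_tensorial X hβ x)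

/-- The Courant bracket
`[[X + α, Y + β]] = [X, Y] + L_X β - L_Y α - (1/2) d(β(X) - α(Y))`. -/
def courant [FiniteDimensional ℝ E] (A B : GSection E M) (x : M) : GT E x :=
  (VectorField.mlieBracket 𝓘(ℝ, E) A.vec B.vec x,
    lieForm A.vec B.form B.smooth_form x - lieForm B.vec A.form A.smooth_form x
      - (1 / 2 : ℝ) • dd E (fun y => B.form y (A.vec y) - A.form y (B.vec y)) x)

/-- The complex bilinear extension of the Courant bracket to `(TM ⊕ T*M) ⊗ ℂ`. A complex section
`U.1 + √-1 U.2` is given by the pair `U` of its real and imaginary parts, and so is the value. -/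
def courantC [FiniteDimensional ℝ E] (U V : GSection E M × GSection E M) (x : M) :
    GT E x × GT E x :=
  (courant U.1 V.1 x - courant U.2 V.2 x, courant U.1 V.2 x + courant U.2 V.1 x)

end Courant

section Structures

/-- `Φ` is a smooth endomorphism of the bundle `TM ⊕ T*M`: it maps smooth sections to smooth
sections. -/
def SmoothEndo [IsManifold 𝓘(ℝ, E) ∞ M] (Φ : Π x : M, GT E x →ₗ[ℝ] GT E x) : Prop :=
  ∀ A : GSection E M,
    SmoothVec E (fun x => (Φ x (A.val x)).1) ∧ SmoothForm E (fun x => (Φ x (A.val x)).2)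

/-- `w.1 + √-1 w.2` lies in `D_x ⊗ ℂ` and in the `√-1`-eigenspace of `Φ_x`. -/
def InEigen (D : Π x : M, Submodule ℝ (GT E x)) (Φ : Π x : M, GT E x →ₗ[ℝ] GT E x) (x : M)
    (w : GT E x × GT E x) : Prop :=
  w.1 ∈ D x ∧ w.2 ∈ D x ∧ Φ x w.1 = -w.2 ∧ Φ x w.2 = w.1

/-- The restriction of `Φ` to the subbundle `D` of `TM ⊕ T*M` is a generalized complex structure:
`Φ` preserves `D`, and on `D` one has `Φ + Φ* = 0`, `Φ² = -Id`, and the `√-1`-eigenbundle of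
`Φ|_D` in `D ⊗ ℂ` is involutive for the Courant bracket. For `D = TM ⊕ T*M` this is a generalized
complex structure on `M`. -/
structure IsGenComplexOn [IsManifold 𝓘(ℝ, E) ∞ M] [FiniteDimensional ℝ E]
    (D : Π x : M, Submodule ℝ (GT E x)) (Φ : Π x : M, GT E x →ₗ[ℝ] GT E x) : Prop where
  maps : ∀ x, ∀ A ∈ D x, Φ x A ∈ D x
  skew : ∀ x, ∀ A ∈ D x, ∀ B ∈ D x, pairing E (Φ x A) B + pairing E A (Φ x B) = 0
  sq : ∀ x, ∀ A ∈ D x, Φ x (Φ x A) = -A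
  involutive : ∀ U V : GSection E M × GSection E M,
    (∀ x, InEigen D Φ x (U.1.val x, U.2.val x)) → (∀ x, InEigen D Φ x (V.1.val x, V.2.val x)) →
      ∀ x, InEigen D Φ x (courantC U V x)

/-- A generalized almost contact structure `(Φ, E₊, E₋)`. Here `(A ⊗ B)(C) = 2⟨B, C⟩ A`, that is,
`TM ⊕ T*M` is identified with its dual by `2⟨·, ·⟩`, the natural pairing. -/
structure IsGenAlmostContact [IsManifold 𝓘(ℝ, E) ∞ M] (Φ : Π x : M, GT E x →ₗ[ℝ] GT E x)
    (Ep Em : GSection E M) : Prop where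
  smooth : SmoothEndo Φ
  skew : ∀ x, ∀ A B : GT E x, pairing E (Φ x A) B + pairing E A (Φ x B) = 0
  sq : ∀ x, ∀ A : GT E x, Φ x (Φ x A) =
    -A + (2 * pairing E (Em.val x) A) • Ep.val x + (2 * pairing E (Ep.val x) A) • Em.val x
  pp : ∀ x, pairing E (Ep.val x) (Ep.val x) = 0
  mm : ∀ x, pairing E (Em.val x) (Em.val x) = 0
  pm : ∀ x, 2 * pairing E (Ep.val x) (Em.val x) = 1

/-- The subbundle `(E₊ ⊕ E₋)^⊥` of `TM ⊕ T*M`. -/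
def perp [IsManifold 𝓘(ℝ, E) ∞ M] (Ep Em : GSection E M) (x : M) : Submodule ℝ (GT E x) where
  carrier := {A | pairing E (Ep.val x) A = 0 ∧ pairing E (Em.val x) A = 0}
  zero_mem' := by simp [pairing]
  add_mem' := by
    rintro A B ⟨h1, h2⟩ ⟨h3, h4⟩
    simp only [pairing, Set.mem_ofPred_eq, Prod.fst_add, Prod.snd_add, map_add,
      add_apply] at *
    constructor <;> linarith
  smul_mem' := by
    rintro c A ⟨h1, h2⟩
    simp only [pairing, Set.mem_ofPred_eq, Prod.smul_fst, Prod.smul_snd, map_smul,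
      smul_apply, smul_eq_mul] at *
    constructor
    · linear_combination c * h1
    · linear_combination c * h2

end Structures

section Poisson

/-- A (pointwise) field of bilinear forms on the cotangent spaces. -/
abbrev BilinField (E : Type u) [NormedAddCommGroup E] [NormedSpace ℝ E]
    (M : Type v) [TopologicalSpace M] [ChartedSpace E M] :=
  Π x : M, TStar E x →ₗ[ℝ] TStar E x →ₗ[ℝ] ℝ

/-- The bracket `{f, g} = P(df, dg)`. -/
def poissonBracket (P : BilinField E M) (f g : M → ℝ) (x : M) : ℝ := P x (dd E f x) (dd E g x)

/-- `P` is a Poisson structure on `M`: a smooth bivector field whose bracket `{f, g} = P(df, dg)`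
on smooth functions satisfies the Jacobi identity (equivalently, `[P, P] = 0`). -/
structure IsPoisson [IsManifold 𝓘(ℝ, E) ∞ M] (P : BilinField E M) : Prop where
  alternating : ∀ x, ∀ α : TStar E x, P x α α = 0
  smooth : ∀ α β : Π x : M, TStar E x, SmoothForm E α → SmoothForm E β →
    SmoothFun E (fun x => P x (α x) (β x))
  jacobi : ∀ f g h : M → ℝ, SmoothFun E f → SmoothFun E g → SmoothFun E h → ∀ x,
    poissonBracket P f (poissonBracket P g h) x + poissonBracket P g (poissonBracket P h f) x
      + poissonBracket P h (poissonBracket P f g) x = 0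

/-- The bivector underlying a skew endomorphism `Φ` of `TM ⊕ T*M`: its block `T*M → TM`, that is,
`P₀(α, β) = β(pr_{TM} Φ(α))`. If `Φ` belongs to a generalized complex structure on `M`, this is its
canonical Poisson structure. If `Φ` belongs to a generalized almost contact structure, `Φ` vanishes
on `E₊`, `E₋`, so it is the extension by zero of its restriction to `(E₊ ⊕ E₋)^⊥`, and `P₀` is the
bivector of that restriction. -/
def canonicalBivector (Φ : Π x : M, GT E x →ₗ[ℝ] GT E x) : BilinField E M := fun x =>
  LinearMap.mk₂ ℝ (fun α β : TStar E x => β (Φ x ((0 : T E x), α)).1)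
    (fun α α' β => by
      have h : ((0 : T E x), α + α') = (0, α) + (0, α') := by simp
      rw [h, map_add, Prod.fst_add, map_add])
    (fun c α β => by
      have h : ((0 : T E x), c • α) = c • (0, α) := by simp
      rw [h, map_smul, Prod.smul_fst, map_smul])
    (fun α β β' => by simp)
    (fun c α β => by simp)

/-- The bivector `X ∧ Y`, `(X ∧ Y)(α, β) = α(X) β(Y) - α(Y) β(X)`. -/
def wedge (X Y : Π x : M, T E x) : BilinField E M := fun x =>
  LinearMap.mk₂ ℝ (fun α β : TStar E x => α (X x) * β (Y x) - α (Y x) * β (X x))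
    (fun α α' β => by simp only [add_apply]; ring)
    (fun c α β => by simp only [smul_apply, smul_eq_mul]; ring)
    (fun α β β' => by simp only [add_apply]; ring)
    (fun c α β => by simp only [smul_apply, smul_eq_mul]; ring)

end Poisson

end GenGeom

end

open GenGeom

/-! Write {f, g} = dg(Φ df) for the bracket of π₀. The hypotheses yield three facts: {·, ·} itself
satisfies the Jacobi identity (`jacobi_map`), e₊ and e₋ are derivations of it
(`deriv_left_bracket`), and e₊, e₋ commute (`deriv_comm`). In Schouten terms, [π₀, π₀], [π₀, e₊ ∧
e₋] and [e₊ ∧ e₋, e₊ ∧ e₋] all vanish, so the sum is Poisson.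

The first two facts come from involutivity. Since Φ³ = -Φ, every section A gives an eigensection Φ²A
+ √-1 ΦA, and for exact sections Φ² df = -df + e₋(f) E₊ + e₊(f) E₋. The bracket of the eigensections
of df and dg is again an eigenvector orthogonal to E±. Orthogonality of its imaginary part to E₊ is
the derivation property. Orthogonality of its real part determines ⟨[[Φ df, E₊]], Φ dh⟩
(`trip_map_left_map`). The eigenvector equation, paired with dh, is the Jacobi identity for π₀ up to
terms in e±, and these cancel by the previous formula and commutation.

No identity for bracket-valued sections is needed: only the scalars `trip A B C` = 2⟨[[A, B]], C⟩
occur, governed by antisymmetry, metric compatibility, the Leibniz rule and the value on exact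
sections. -/

namespace GenGeom

open Filter Topology

variable {E : Type*} [NormedAddCommGroup E] [NormedSpace ℝ E]
  {M : Type*} [TopologicalSpace M] [ChartedSpace E M]

/-! ### Linear algebra of the pairing, and the Lie bracket in a vector space -/

theorem pairing_comm {x : M} (A B : GT E x) : pairing E A B = pairing E B A := by
  simp only [pairing, add_comm]

theorem pairing_add_right {x : M} (A B C : GT E x) :
    pairing E A (B + C) = pairing E A B + pairing E A C := by
  simp only [pairing, Prod.fst_add, Prod.snd_add, map_add, add_apply]; ring

theorem pairing_smul_right {x : M} (c : ℝ) (A B : GT E x) :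
    pairing E A (c • B) = c * pairing E A B := by
  simp only [pairing, Prod.smul_fst, Prod.smul_snd, map_smul, smul_apply, smul_eq_mul]; ring

theorem pairing_neg_right {x : M} (A B : GT E x) : pairing E A (-B) = -pairing E A B := by
  simp only [pairing, Prod.fst_neg, Prod.snd_neg, map_neg, neg_apply]; ring

theorem pairing_sub_right {x : M} (A B C : GT E x) :
    pairing E A (B - C) = pairing E A B - pairing E A C := by
  rw [sub_eq_add_neg, pairing_add_right, pairing_neg_right, sub_eq_add_neg]

theorem SmoothFun.mdifferentiableAt {f : M → ℝ} (hf : SmoothFun E f) (x : M) :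
    MDifferentiableAt 𝓘(ℝ, E) 𝓘(ℝ, ℝ) f x :=
  (hf x).mdifferentiableAt (by simp)

/-- The Lie bracket of vector fields acts on functions as the commutator of derivations, in a
vector space. -/
theorem fderiv_lieBracket_apply {V W : E → E} {f : E → ℝ} {x : E}
    (hV : DifferentiableAt ℝ V x) (hW : DifferentiableAt ℝ W x) (hf : ContDiffAt ℝ 2 f x) :
    fderiv ℝ f x (VectorField.lieBracket ℝ V W x) =
      fderiv ℝ (fun y => fderiv ℝ f y (W y)) x (V x)
        - fderiv ℝ (fun y => fderiv ℝ f y (V y)) x (W x) := by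
  have hd : DifferentiableAt ℝ (fderiv ℝ f) x :=
    (hf.fderiv_right (m := 1) (by norm_num)).differentiableAt (by simp)
  have hs : IsSymmSndFDerivAt ℝ f x := hf.isSymmSndFDerivAt (by simp)
  rw [fderiv_clm_apply hd hW, fderiv_clm_apply hd hV]
  simp [VectorField.lieBracket, hs.eq (V x) (W x)]

variable [IsManifold 𝓘(ℝ, E) ∞ M]

/-! ### Smooth vector fields and 1-forms -/

theorem SmoothVec.mdifferentiableAt {X : Π x : M, T E x} (hX : SmoothVec E X) (x : M) :
    MDifferentiableAt 𝓘(ℝ, E) (𝓘(ℝ, E).prod 𝓘(ℝ, E))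
      (fun x => (Bundle.TotalSpace.mk' E x (X x) : TangentBundle 𝓘(ℝ, E) M)) x :=
  (hX x).mdifferentiableAt (by simp)

theorem SmoothForm.apply {β : Π x : M, TStar E x} (hβ : SmoothForm E β) {Z : Π x : M, T E x}
    (hZ : SmoothVec E Z) : SmoothFun E (fun y => β y (Z y)) := by
  have : IsManifold 𝓘(ℝ, E) 1 M := IsManifold.of_le (n := ∞) (by simp)
  intro x
  have h := ContMDiffAt.clm_bundle_apply (𝕜 := ℝ) (F₁ := E) (F₂ := ℝ)
    (E₂ := Bundle.Trivial M ℝ) (b := fun y : M => y) (hβ x) (hZ x)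
  rw [Bundle.contMDiffAt_totalSpace] at h
  exact h.2

/-- In tangent coordinates the derivative of a smooth map is smooth; the target being ℝ, these
coordinates agree with those of the bundle Hom(TM, ℝ). -/
theorem SmoothFun.dd {f : M → ℝ} (hf : SmoothFun E f) : SmoothForm E (GenGeom.dd E f) := by
  have : IsManifold 𝓘(ℝ, E) 1 M := IsManifold.of_le (n := ∞) (by simp)
  intro x₀
  rw [contMDiffAt_hom_bundle]
  refine ⟨contMDiffAt_id, ?_⟩
  have h := (hf x₀).mfderiv_const (m := ∞) (by simp)
  refine h.congr_of_eventuallyEq (Eventually.of_forall fun x => ?_)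
  simp only [inTangentCoordinates, ContinuousLinearMap.inCoordinates,
    TangentBundle.continuousLinearMapAt_model_space, id]
  ext v
  simp [mvfderiv]
  rfl

theorem SmoothVec.add {X Y : Π x : M, T E x} (hX : SmoothVec E X) (hY : SmoothVec E Y) :
    SmoothVec E (X + Y) := by
  have : IsManifold 𝓘(ℝ, E) 1 M := IsManifold.of_le (n := ∞) (by simp)
  exact ContMDiff.add_section hX hY

theorem SmoothVec.smul {f : M → ℝ} {X : Π x : M, T E x} (hf : SmoothFun E f)
    (hX : SmoothVec E X) : SmoothVec E (fun x => f x • X x) := by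
  have : IsManifold 𝓘(ℝ, E) 1 M := IsManifold.of_le (n := ∞) (by simp)
  exact ContMDiff.smul_section hf hX

theorem SmoothVec.zero : SmoothVec E (fun _ : M => 0) := by
  have : IsManifold 𝓘(ℝ, E) 1 M := IsManifold.of_le (n := ∞) (by simp)
  exact Bundle.contMDiff_zeroSection ℝ (TangentSpace 𝓘(ℝ, E) : M → Type _)

theorem SmoothForm.add {X Y : Π x : M, TStar E x} (hX : SmoothForm E X) (hY : SmoothForm E Y) :
    SmoothForm E (X + Y) := by
  have : IsManifold 𝓘(ℝ, E) 1 M := IsManifold.of_le (n := ∞) (by simp)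
  exact ContMDiff.add_section
    (V := fun y : M => TangentSpace 𝓘(ℝ, E) y →L[ℝ] Bundle.Trivial M ℝ y) hX hY

theorem SmoothForm.smul {f : M → ℝ} {X : Π x : M, TStar E x} (hf : SmoothFun E f)
    (hX : SmoothForm E X) : SmoothForm E (fun x => f x • X x) := by
  have : IsManifold 𝓘(ℝ, E) 1 M := IsManifold.of_le (n := ∞) (by simp)
  exact ContMDiff.smul_section
    (V := fun y : M => TangentSpace 𝓘(ℝ, E) y →L[ℝ] Bundle.Trivial M ℝ y) hf hX

/-! ### The Lie bracket as a commutator, on a manifold -/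

/-- The Lie bracket of vector fields acts on functions as the commutator of derivations. -/
theorem dd_mlieBracket_apply [FiniteDimensional ℝ E] {V W : Π x : M, T E x} {f : M → ℝ}
    (hV : SmoothVec E V) (hW : SmoothVec E W) (hf : SmoothFun E f) (x : M) :
    dd E f x (VectorField.mlieBracket 𝓘(ℝ, E) V W x) =
      dd E (fun y => dd E f y (W y)) x (V x) - dd E (fun y => dd E f y (V y)) x (W x) := by
  have : IsManifold 𝓘(ℝ, E) 1 M := IsManifold.of_le (n := ∞) (by simp)
  have two_le : (2 : ℕ∞ω) ≤ ∞ := WithTop.coe_le_coe.2 (le_top : (2 : ℕ∞) ≤ ⊤)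
  have three_le : (3 : ℕ∞ω) ≤ ∞ := WithTop.coe_le_coe.2 (le_top : (3 : ℕ∞) ≤ ⊤)
  have : IsManifold 𝓘(ℝ, E) 2 M := IsManifold.of_le two_le
  have : IsManifold 𝓘(ℝ, E) (minSmoothness ℝ 2) M := by simpa
  have : IsManifold 𝓘(ℝ, E) (minSmoothness ℝ 3) M :=
    IsManifold.of_le (n := ∞) (by simpa using three_le)
  have : CompleteSpace E := FiniteDimensional.complete ℝ E
  -- Everything is pulled back along the inverse chart ψ, where the vector space case applies.
  set ψ := (extChartAt 𝓘(ℝ, E) x).symm with hψ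
  set y₀ := extChartAt 𝓘(ℝ, E) x x with hy₀
  have hx : ψ y₀ = x := extChartAt_to_inv x
  have ht : (extChartAt 𝓘(ℝ, E) x).target ∈ 𝓝 y₀ := extChartAt_target_mem_nhds x
  have hsm : ∀ y ∈ (extChartAt 𝓘(ℝ, E) x).target, ContMDiffAt 𝓘(ℝ, E) 𝓘(ℝ, E) ∞ ψ y := fun y hy =>
    (contMDiffOn_extChartAt_symm x).contMDiffAt ((isOpen_extChartAt_target x).mem_nhds hy)
  have hinv : ∀ y ∈ (extChartAt 𝓘(ℝ, E) x).target,
      (mfderiv 𝓘(ℝ, E) 𝓘(ℝ, E) ψ y).IsInvertible := fun y hy => by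
    have := isInvertible_mfderivWithin_extChartAt_symm (I := 𝓘(ℝ, E)) hy
    simpa only [modelWithCornersSelf_coe, Set.range_id, mfderivWithin_univ] using this
  -- The pullback of U carries the inverse of the derivative of ψ, which cancels the factor from the
  -- chain rule.
  have key : ∀ {g : M → ℝ} (_ : SmoothFun E g) (U : Π x : M, T E x),
      ∀ y ∈ (extChartAt 𝓘(ℝ, E) x).target,
      fderiv ℝ (g ∘ ψ) y (VectorField.mpullback 𝓘(ℝ, E) 𝓘(ℝ, E) ψ U y) = dd E g (ψ y) (U (ψ y)) := by
    intro g hg U y hy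
    rw [← mfderiv_eq_fderiv, mfderiv_comp y (hg.mdifferentiableAt _)
      ((hsm y hy).mdifferentiableAt (by simp)), VectorField.mpullback_apply]
    change mfderiv 𝓘(ℝ, E) 𝓘(ℝ, ℝ) g (ψ y) (mfderiv 𝓘(ℝ, E) 𝓘(ℝ, E) ψ y _) = _
    rw [(hinv y hy).self_apply_inverse]
    rfl
  have hdiff : ∀ {U : Π x : M, T E x}, SmoothVec E U →
      DifferentiableAt ℝ (VectorField.mpullback 𝓘(ℝ, E) 𝓘(ℝ, E) ψ U) y₀ := by
    intro U hU
    have := MDifferentiableAt.mpullback_vectorField (hU.mdifferentiableAt (ψ y₀))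
      ((hsm y₀ (mem_of_mem_nhds ht)).of_le two_le)
      (hinv y₀ (mem_of_mem_nhds ht)) le_rfl
    exact ((contMDiff_snd_tangentBundle_modelSpace E 𝓘(ℝ, E)).contMDiffAt.mdifferentiableAt
      one_ne_zero |>.comp y₀ this).differentiableAt
  have hfψ : ContDiffAt ℝ 2 (f ∘ ψ) y₀ :=
    (((hf (ψ y₀)).comp y₀ (hsm y₀ (mem_of_mem_nhds ht))).contDiffAt).of_le
      two_le
  have h1 := fderiv_lieBracket_apply (hdiff hV) (hdiff hW) hfψ
  have h2 := VectorField.mpullback_mlieBracket (hV.mdifferentiableAt (ψ y₀))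
    (hW.mdifferentiableAt (ψ y₀)) (hsm y₀ (mem_of_mem_nhds ht)) (by simpa using two_le)
  have h3 : ∀ {U U' : Π x : M, T E x}, SmoothVec E U →
      fderiv ℝ (fun y => fderiv ℝ (f ∘ ψ) y (VectorField.mpullback 𝓘(ℝ, E) 𝓘(ℝ, E) ψ U y)) y₀
        (VectorField.mpullback 𝓘(ℝ, E) 𝓘(ℝ, E) ψ U' y₀)
      = dd E (fun y => dd E f y (U y)) (ψ y₀) (U' (ψ y₀)) := by
    intro U U' hU
    -- The inner derivative is again a smooth function on M, so `key` is used twice; the inner use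
    -- holds only on the chart target, a neighbourhood of y₀, which suffices for the outer
    -- derivative.
    rw [← key (hf.dd.apply hU) U' y₀ (mem_of_mem_nhds ht)]
    congr 1
    apply EventuallyEq.fderiv_eq
    filter_upwards [ht] with y hy
    exact key hf U y hy
  rw [h3 hW, h3 hV] at h1
  rw [← hx, ← h1, ← key hf _ y₀ (mem_of_mem_nhds ht), h2,
    ← VectorField.mlieBracketWithin_univ, VectorField.mlieBracketWithin_eq_lieBracketWithin]
  exact congrArg _ (congrFun VectorField.lieBracketWithin_univ y₀)

theorem lieForm_apply [FiniteDimensional ℝ E] (X : Π x : M, T E x) {β : Π x : M, TStar E x}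
    (hβ : SmoothForm E β) {Z : Π x : M, T E x} (hZ : SmoothVec E Z) (x : M) :
    lieForm X β hβ x (Z x) = lieFormAux X β x Z := by
  have : IsManifold 𝓘(ℝ, E) 1 M := IsManifold.of_le (n := ∞) (by simp)
  exact TensorialAt.mkHom_apply (lieFormAux_tensorial X hβ x) (hZ.mdifferentiableAt x)

/-! ### Sections and their action on functions -/

namespace GSection

@[ext]
theorem ext_vec_form {A B : GSection E M} (h1 : ∀ x, A.vec x = B.vec x)
    (h2 : ∀ x, A.form x = B.form x) :
    A = B := by
  cases A; cases B
  simp only [mk.injEq]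
  exact ⟨funext h1, funext h2⟩

/-- The sum of two sections. -/
noncomputable def add (A B : GSection E M) : GSection E M :=
  ⟨A.vec + B.vec, A.form + B.form, A.smooth_vec.add B.smooth_vec, A.smooth_form.add B.smooth_form⟩

/-- The product of a section by a smooth function. -/
noncomputable def smul (f : M → ℝ) (hf : SmoothFun E f) (A : GSection E M) : GSection E M :=
  ⟨fun x => f x • A.vec x, fun x => f x • A.form x, A.smooth_vec.smul hf, A.smooth_form.smul hf⟩

/-- The differential of a smooth function, as a section. -/
noncomputable def exact (f : M → ℝ) (hf : SmoothFun E f) : GSection E M :=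
  ⟨fun _ => 0, dd E f, SmoothVec.zero, hf.dd⟩

/-- The image of a section under a smooth endomorphism. -/
noncomputable def map {Φ : Π x : M, GT E x →ₗ[ℝ] GT E x} (hΦ : SmoothEndo Φ) (A : GSection E M) :
    GSection E M :=
  ⟨fun x => (Φ x (A.val x)).1, fun x => (Φ x (A.val x)).2, (hΦ A).1, (hΦ A).2⟩

/-- The natural pairing `2⟨A, B⟩` of two sections. -/
noncomputable def ip (A B : GSection E M) (x : M) : ℝ := 2 * pairing E (A.val x) (B.val x)

/-- The derivative of a function along the vector part of a section. -/
noncomputable def deriv (A : GSection E M) (f : M → ℝ) (x : M) : ℝ := dd E f x (A.vec x)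

/-- The natural pairing of `[[A, B]]` with `C`. -/
noncomputable def trip [FiniteDimensional ℝ E] (A B C : GSection E M) (x : M) : ℝ :=
  2 * pairing E (courant A B x) (C.val x)

theorem ip_eq (A B : GSection E M) (x : M) :
    ip A B x = B.form x (A.vec x) + A.form x (B.vec x) := by
  simp [ip, pairing, val]; ring

theorem smooth_deriv (A : GSection E M) {f : M → ℝ} (hf : SmoothFun E f) :
    SmoothFun E (A.deriv f) :=
  hf.dd.apply A.smooth_vec

theorem deriv_add (A : GSection E M) {f g : M → ℝ} (hf : SmoothFun E f) (hg : SmoothFun E g)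
    (x : M) : A.deriv (fun y => f y + g y) x = A.deriv f x + A.deriv g x := by
  simp only [deriv, dd]
  rw [mvfderiv_fun_add (hf.mdifferentiableAt x) (hg.mdifferentiableAt x)]
  rfl

theorem deriv_neg (A : GSection E M) {f : M → ℝ}
    (x : M) : A.deriv (fun y => -f y) x = -A.deriv f x := by
  simp only [deriv, dd]
  rw [mvfderiv_fun_neg]
  rfl

theorem deriv_sub (A : GSection E M) {f g : M → ℝ} (hf : SmoothFun E f) (hg : SmoothFun E g)
    (x : M) : A.deriv (fun y => f y - g y) x = A.deriv f x - A.deriv g x := by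
  simp only [deriv, dd]
  rw [mvfderiv_fun_sub (hf.mdifferentiableAt x) (hg.mdifferentiableAt x)]
  rfl

theorem deriv_mul (A : GSection E M) {f g : M → ℝ} (hf : SmoothFun E f) (hg : SmoothFun E g)
    (x : M) : A.deriv (fun y => f y * g y) x = f x * A.deriv g x + g x * A.deriv f x := by
  simp only [deriv, dd]
  rw [mvfderiv_fun_mul (hf.mdifferentiableAt x) (hg.mdifferentiableAt x)]
  rfl

theorem deriv_const (A : GSection E M) (c : ℝ) (x : M) : A.deriv (fun _ => c) x = 0 := by
  simp only [deriv, dd]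
  rw [mvfderiv_const]
  rfl

/-! ### The Courant bracket tested against a section -/

section Courant

variable [FiniteDimensional ℝ E]

/-- The bracket of the vector parts, acting on functions, is the commutator. -/
theorem dd_mlieBracket (A B : GSection E M) {f : M → ℝ} (hf : SmoothFun E f) (x : M) :
    dd E f x (VectorField.mlieBracket 𝓘(ℝ, E) A.vec B.vec x) =
      A.deriv (B.deriv f) x - B.deriv (A.deriv f) x :=
  dd_mlieBracket_apply A.smooth_vec B.smooth_vec hf x

/-- Testing against C evaluates the Lie derivatives of forms on `C.vec`, leaving only derivatives of
functions and Lie brackets. The identities below then follow by `ring`. -/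
theorem trip_eq (A B C : GSection E M) (x : M) :
    trip A B C x = A.deriv (fun y => B.form y (C.vec y)) x
      - B.form x (VectorField.mlieBracket 𝓘(ℝ, E) A.vec C.vec x)
      - B.deriv (fun y => A.form y (C.vec y)) x
      + A.form x (VectorField.mlieBracket 𝓘(ℝ, E) B.vec C.vec x)
      - 1 / 2 * C.deriv (fun y => B.form y (A.vec y)) x
      + 1 / 2 * C.deriv (fun y => A.form y (B.vec y)) x
      + C.form x (VectorField.mlieBracket 𝓘(ℝ, E) A.vec B.vec x) := by
  have hs := C.deriv_sub (B.smooth_form.apply A.smooth_vec) (A.smooth_form.apply B.smooth_vec) x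
  simp only [trip, pairing, courant, val, sub_apply, smul_apply, smul_eq_mul,
    lieForm_apply _ _ C.smooth_vec, lieFormAux]
  simp only [deriv] at hs ⊢
  rw [hs]
  ring

theorem trip_antisymm (A B C : GSection E M) (x : M) : trip A B C x = -trip B A C x := by
  rw [trip_eq, trip_eq, VectorField.mlieBracket_swap_apply (V := A.vec) (W := B.vec), map_neg]
  ring

/-- The Courant bracket is compatible with the metric. -/
theorem deriv_ip (A B C : GSection E M) (x : M) :
    A.deriv (ip B C) x = trip A B C x + trip A C B x
      + 1 / 2 * (C.deriv (ip A B) x + B.deriv (ip A C) x) := by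
  have e : ∀ A B : GSection E M, ip A B = fun x => B.form x (A.vec x) + A.form x (B.vec x) :=
    fun A B => funext (ip_eq A B)
  have s := fun A B : GSection E M => B.smooth_form.apply A.smooth_vec
  simp only [e, deriv_add _ (s _ _) (s _ _), trip_eq]
  -- The two `trip` terms contain [B, C] and [C, B]. The exact parts of the skew bracket account for
  -- the ½ correction terms.
  rw [VectorField.mlieBracket_swap_apply (V := B.vec) (W := C.vec), map_neg]
  ring

theorem trip_add (A B B' C : GSection E M) (x : M) :
    trip A (B.add B') C x = trip A B C x + trip A B' C x := by
  have : IsManifold 𝓘(ℝ, E) 1 M := IsManifold.of_le (n := ∞) (by simp)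
  have : CompleteSpace E := FiniteDimensional.complete ℝ E
  have s := fun A B : GSection E M => B.smooth_form.apply A.smooth_vec
  simp only [trip_eq, add, Pi.add_apply, add_apply, map_add, deriv_add _ (s _ _) (s _ _)]
  rw [VectorField.mlieBracket_add_right (B.smooth_vec.mdifferentiableAt x)
      (B'.smooth_vec.mdifferentiableAt x),
    VectorField.mlieBracket_add_left (B.smooth_vec.mdifferentiableAt x)
      (B'.smooth_vec.mdifferentiableAt x)]
  simp only [deriv, Pi.add_apply, map_add]
  ring

/-- The Leibniz rule for the Courant bracket. -/
theorem trip_smul (A : GSection E M) {f : M → ℝ} (hf : SmoothFun E f) (B C : GSection E M)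
    (x : M) :
    trip A (smul f hf B) C x = f x * trip A B C x + A.deriv f x * ip B C x
      - 1 / 2 * ip A B x * C.deriv f x := by
  have : IsManifold 𝓘(ℝ, E) 1 M := IsManifold.of_le (n := ∞) (by simp)
  have : CompleteSpace E := FiniteDimensional.complete ℝ E
  have s := fun A B : GSection E M => B.smooth_form.apply A.smooth_vec
  have hv : ∀ y, (smul f hf B).vec y = f y • B.vec y := fun _ => rfl
  have hα : ∀ y, (smul f hf B).form y = f y • B.form y := fun _ => rfl
  have hr : VectorField.mlieBracket 𝓘(ℝ, E) A.vec (smul f hf B).vec x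
      = A.deriv f x • B.vec x + f x • VectorField.mlieBracket 𝓘(ℝ, E) A.vec B.vec x :=
    VectorField.mlieBracket_smul_right (hf.mdifferentiableAt x) (B.smooth_vec.mdifferentiableAt x)
  have hl : VectorField.mlieBracket 𝓘(ℝ, E) (smul f hf B).vec C.vec x
      = -C.deriv f x • B.vec x + f x • VectorField.mlieBracket 𝓘(ℝ, E) B.vec C.vec x :=
    VectorField.mlieBracket_smul_left (hf.mdifferentiableAt x) (B.smooth_vec.mdifferentiableAt x)
  have hd : ∀ g, (smul f hf B).deriv g x = f x * B.deriv g x := fun g => by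
    simp [deriv, hv]
  simp only [trip_eq, hr, hl, hd, hv, hα, smul_apply, map_smul, map_add, smul_eq_mul,
    deriv_mul _ hf (s _ _), ip_eq]
  ring

/-- With X the vector part of A, L_X df = d(Xf), and the exact term of the bracket removes half of
it: [[A, df]] = ½ d(Xf). -/
theorem trip_exact (A : GSection E M) {f : M → ℝ} (hf : SmoothFun E f) (C : GSection E M) (x : M) :
    trip A (exact f hf) C x = 1 / 2 * C.deriv (A.deriv f) x := by
  have hv : ∀ y, (exact f hf).vec y = 0 := fun _ => rfl
  have hα : ∀ y, (exact f hf).form y = dd E f y := fun _ => rfl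
  have hr : VectorField.mlieBracket 𝓘(ℝ, E) A.vec (exact f hf).vec x = 0 :=
    congrFun VectorField.mlieBracket_zero_right x
  have hl : VectorField.mlieBracket 𝓘(ℝ, E) (exact f hf).vec C.vec x = 0 :=
    congrFun VectorField.mlieBracket_zero_left x
  have hd : ∀ g, (exact f hf).deriv g x = 0 := fun g => by simp [deriv, hv]
  have hc : ∀ B : GSection E M, (fun y => dd E f y (B.vec y)) = B.deriv f := fun _ => rfl
  simp only [trip_eq, hr, hl, hd, hv, hα, map_zero, hc, dd_mlieBracket A C hf, deriv_const]
  ring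

end Courant
end GSection

/-! ### Pointwise algebra of Φ -/

variable {Φ : Π x : M, GT E x →ₗ[ℝ] GT E x} {Ep Em : GSection E M}

theorem perp_comm (Ep Em : GSection E M) : perp Ep Em = perp Em Ep := by
  funext x
  ext A
  exact and_comm

namespace IsGenAlmostContact

/-- The roles of E₊ and E₋ are interchangeable, so results are proved for E₊ only and transferred to
E₋ through this. -/
theorem symm (hΦ : IsGenAlmostContact Φ Ep Em) : IsGenAlmostContact Φ Em Ep where
  smooth := hΦ.smooth
  skew := hΦ.skew
  sq x A := by rw [hΦ.sq x A]; abel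
  pp := hΦ.mm
  mm := hΦ.pp
  pm x := by rw [pairing_comm]; exact hΦ.pm x

/-- `Φ` vanishes on `E₊`. -/
theorem map_left (hΦ : IsGenAlmostContact Φ Ep Em) (x : M) : Φ x (Ep.val x) = 0 := by
  have hpm := hΦ.pm x
  have hpp := hΦ.pp x
  have hsq : Φ x (Φ x (Ep.val x)) = 0 := by
    rw [hΦ.sq, pairing_comm (Em.val x), hpm, hpp]
    simp
  have hsk : pairing E (Ep.val x) (Φ x (Ep.val x)) = 0 := by
    have := hΦ.skew x (Ep.val x) (Ep.val x)
    rw [pairing_comm (Φ x _)] at this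
    linarith
  -- Φ² kills E₊, so the formula for Φ² at Φ E₊ forces Φ E₊ = c E₊. Then c² E₊ = 0, and pairing with
  -- E₋ gives c = 0.
  set c := 2 * pairing E (Em.val x) (Φ x (Ep.val x)) with hc
  have h1 : Φ x (Ep.val x) = c • Ep.val x := by
    have := hΦ.sq x (Φ x (Ep.val x))
    rw [hsq, map_zero, hsk, ← hc, mul_zero, zero_smul, add_zero] at this
    have h := eq_neg_of_add_eq_zero_right this.symm
    rw [h, neg_neg]
  have h2 : (c * c) • Ep.val x = 0 := by
    rw [← hsq, h1, map_smul, h1, smul_smul]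
  have h3 : c * c = 0 := by
    have := congrArg (pairing E (Em.val x)) h2
    rw [pairing_smul_right, pairing_comm (Em.val x)] at this
    have h0 : pairing E (Em.val x) 0 = 0 := by simp [pairing]
    rw [h0] at this
    linear_combination 2 * this - c * c * hpm
  rw [h1, mul_self_eq_zero.1 h3, zero_smul]

theorem pairing_left_map (hΦ : IsGenAlmostContact Φ Ep Em) {x : M} (A : GT E x) :
    pairing E (Ep.val x) (Φ x A) = 0 := by
  have := hΦ.skew x (Ep.val x) A
  rw [hΦ.map_left] at this
  simpa [pairing] using this

theorem cube (hΦ : IsGenAlmostContact Φ Ep Em) {x : M} (A : GT E x) :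
    Φ x (Φ x (Φ x A)) = -Φ x A := by
  rw [hΦ.sq x (Φ x A), hΦ.pairing_left_map, hΦ.symm.pairing_left_map]
  simp

end IsGenAlmostContact

/-! ### Φ on exact sections and the induced bracket of functions -/

namespace GSection

theorem ip_comm (A B : GSection E M) : ip A B = ip B A := by
  funext x; rw [ip, ip, pairing_comm]

theorem val_map (h : SmoothEndo Φ) (A : GSection E M) (x : M) :
    (map h A).val x = Φ x (A.val x) := rfl

theorem ip_exact_right (A : GSection E M) {f : M → ℝ} (hf : SmoothFun E f) :
    ip A (exact f hf) = A.deriv f := by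
  funext x
  rw [ip_eq]
  simp [exact, deriv]

theorem trip_exact_right [FiniteDimensional ℝ E] (A B : GSection E M) {f : M → ℝ}
    (hf : SmoothFun E f) (x : M) :
    trip A B (exact f hf) x = A.deriv (B.deriv f) x - B.deriv (A.deriv f) x := by
  rw [← dd_mlieBracket A B hf]
  simp [trip, pairing, val, exact, courant]
  ring

theorem deriv_mul_add_mul (A : GSection E M) {a b c d : M → ℝ} (ha : SmoothFun E a)
    (hb : SmoothFun E b) (hc : SmoothFun E c) (hd : SmoothFun E d) (x : M) :
    A.deriv (fun y => a y * b y + c y * d y) x =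
      a x * A.deriv b x + b x * A.deriv a x + (c x * A.deriv d x + d x * A.deriv c x) := by
  rw [deriv_add A (f := fun y => a y * b y) (g := fun y => c y * d y) (ha.mul hb) (hc.mul hd),
    deriv_mul A ha hb, deriv_mul A hc hd]

theorem ip_left_map (hΦ : IsGenAlmostContact Φ Ep Em) (A : GSection E M) :
    ip Ep (map hΦ.smooth A) = fun _ => 0 := by
  funext x
  rw [ip, val_map, hΦ.pairing_left_map, mul_zero]

theorem ip_map_left (hΦ : IsGenAlmostContact Φ Ep Em) (A : GSection E M) :
    ip (map hΦ.smooth A) Ep = fun _ => 0 := by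
  rw [ip_comm, ip_left_map hΦ]

theorem ip_map_map (hΦ : IsGenAlmostContact Φ Ep Em) (A B : GSection E M) (x : M) :
    ip (map hΦ.smooth A) (map hΦ.smooth B) x = -ip A (map hΦ.smooth (map hΦ.smooth B)) x := by
  have := hΦ.skew x (A.val x) (Φ x (B.val x))
  simp only [ip, val_map]
  linarith

/-- `Φ² df = -df + e₋(f) E₊ + e₊(f) E₋`. -/
theorem map_map_exact (hΦ : IsGenAlmostContact Φ Ep Em) {f : M → ℝ} (hf : SmoothFun E f) :
    map hΦ.smooth (map hΦ.smooth (exact f hf)) =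
      ((smul (fun _ => -1) contMDiff_const (exact f hf)).add
        (smul (Em.deriv f) (Em.smooth_deriv hf) Ep)).add
        (smul (Ep.deriv f) (Ep.smooth_deriv hf) Em) := by
  have key : ∀ x, (map hΦ.smooth (map hΦ.smooth (exact f hf))).val x =
      -(exact f hf).val x + Em.deriv f x • Ep.val x + Ep.deriv f x • Em.val x := by
    intro x
    rw [val_map, val_map, hΦ.sq, ← ip_exact_right Ep hf, ← ip_exact_right Em hf]
    rfl
  ext x
  · exact (congrArg Prod.fst (key x)).trans (by simp [add, smul, exact, val])
  · rw [show (map hΦ.smooth (map hΦ.smooth (exact f hf))).form x = _ from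
      congrArg Prod.snd (key x)]
    simp [add, smul, exact, val]

theorem deriv_map_map_exact (hΦ : IsGenAlmostContact Φ Ep Em) {f : M → ℝ} (hf : SmoothFun E f)
    (g : M → ℝ) :
    (map hΦ.smooth (map hΦ.smooth (exact f hf))).deriv g =
      fun x => Em.deriv f x * Ep.deriv g x + Ep.deriv f x * Em.deriv g x := by
  funext x
  rw [map_map_exact hΦ hf]
  simp [deriv, add, smul, exact]

/-- The bracket `{f, g} = dg(Φ df)` is skew. -/
theorem deriv_map_exact_swap (hΦ : IsGenAlmostContact Φ Ep Em) {f g : M → ℝ}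
    (hf : SmoothFun E f) (hg : SmoothFun E g) :
    (map hΦ.smooth (exact f hf)).deriv g = fun x => -(map hΦ.smooth (exact g hg)).deriv f x := by
  funext x
  have := hΦ.skew x ((exact f hf).val x) ((exact g hg).val x)
  rw [pairing_comm ((exact f hf).val x)] at this
  rw [← ip_exact_right _ hg, ← ip_exact_right _ hf, ip, ip, val_map, val_map]
  linarith

/-- The derivative of `{g, h} + e₊(g) e₋(h) - e₋(g) e₊(h)`. -/
theorem deriv_bracket (D X : GSection E M) {g h : M → ℝ} (hg : SmoothFun E g)
    (hh : SmoothFun E h) (x : M) :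
    D.deriv (fun y => X.deriv h y +
        (Ep.deriv g y * Em.deriv h y - Em.deriv g y * Ep.deriv h y)) x =
      D.deriv (X.deriv h) x
        + (Ep.deriv g x * D.deriv (Em.deriv h) x + Em.deriv h x * D.deriv (Ep.deriv g) x
        - (Em.deriv g x * D.deriv (Ep.deriv h) x + Ep.deriv h x * D.deriv (Em.deriv g) x)) := by
  have h1 : SmoothFun E (fun y => Ep.deriv g y * Em.deriv h y) :=
    (Ep.smooth_deriv hg).mul (Em.smooth_deriv hh)
  have h2 : SmoothFun E (fun y => Em.deriv g y * Ep.deriv h y) :=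
    (Em.smooth_deriv hg).mul (Ep.smooth_deriv hh)
  have h3 : SmoothFun E (fun y => Ep.deriv g y * Em.deriv h y - Em.deriv g y * Ep.deriv h y) :=
    h1.sub h2
  rw [deriv_add D (X.smooth_deriv hh) h3, deriv_sub D h1 h2,
    deriv_mul D (Ep.smooth_deriv hg) (Em.smooth_deriv hh),
    deriv_mul D (Em.smooth_deriv hg) (Ep.smooth_deriv hh)]

theorem poissonBracket_eq (hΦ : IsGenAlmostContact Φ Ep Em) {f : M → ℝ} (hf : SmoothFun E f)
    (g : M → ℝ) :
    poissonBracket (canonicalBivector Φ + wedge Ep.vec Em.vec) f g =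
      fun x => (map hΦ.smooth (exact f hf)).deriv g x
        + (Ep.deriv f x * Em.deriv g x - Em.deriv f x * Ep.deriv g x) := rfl

/-! ### Brackets with E± and consequences of involutivity -/

variable [FiniteDimensional ℝ E]

/-- Eliminates Φ² from the second slot, by the formula for Φ² df and the Leibniz rule. -/
theorem trip_map_map_exact (hΦ : IsGenAlmostContact Φ Ep Em) {f : M → ℝ} (hf : SmoothFun E f)
    (A C : GSection E M) (x : M) :
    trip A (map hΦ.smooth (map hΦ.smooth (exact f hf))) C x =
      -(1 / 2) * C.deriv (A.deriv f) x
      + (Em.deriv f x * trip A Ep C x + A.deriv (Em.deriv f) x * ip Ep C x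
        - 1 / 2 * ip A Ep x * C.deriv (Em.deriv f) x)
      + (Ep.deriv f x * trip A Em C x + A.deriv (Ep.deriv f) x * ip Em C x
        - 1 / 2 * ip A Em x * C.deriv (Ep.deriv f) x) := by
  rw [map_map_exact hΦ hf]
  simp only [trip_add, trip_smul, trip_exact, deriv_const]
  ring

/-- All inner products among E₊ and ΦA are constant, so metric compatibility moves the bracket onto
[[E₊, E₊]] = 0. -/
theorem trip_left_map_left (hΦ : IsGenAlmostContact Φ Ep Em) (A : GSection E M) (x : M) :
    trip Ep (map hΦ.smooth A) Ep x = 0 := by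
  have h := deriv_ip Ep (map hΦ.smooth A) Ep x
  have h1 := trip_antisymm Ep Ep (map hΦ.smooth A) x
  have h2 : ip Ep Ep = fun _ => 0 := by funext x; rw [ip, hΦ.pp, mul_zero]
  rw [h2, ip_map_left hΦ, ip_left_map hΦ, deriv_const, deriv_const] at h
  linarith

theorem trip_eq_zero_of_courant (hb : ∀ x, courant Ep Em x = 0) (C : GSection E M) (x : M) :
    trip Ep Em C x = 0 := by
  rw [trip, hb, pairing_comm]
  simp [pairing]

/-- As for E₊, metric compatibility reduces this to [[E₊, E₋]], which vanishes by hypothesis. -/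
theorem trip_left_map_right (hΦ : IsGenAlmostContact Φ Ep Em) (hb : ∀ x, courant Ep Em x = 0)
    (A : GSection E M) (x : M) :
    trip Ep (map hΦ.smooth A) Em x = 0 := by
  have h := deriv_ip Ep (map hΦ.smooth A) Em x
  have h2 : ip Ep Em = fun _ => 1 := by funext x; rw [ip, hΦ.pm]
  rw [h2, trip_eq_zero_of_courant hb, ip_map_left hΦ.symm, ip_left_map hΦ, deriv_const, deriv_const,
    deriv_const] at h
  linarith

/-- `[e₊, e₋] = 0`, on functions. -/
theorem deriv_comm (hb : ∀ x, courant Ep Em x = 0) {f : M → ℝ} (hf : SmoothFun E f) (x : M) :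
    Ep.deriv (Em.deriv f) x = Em.deriv (Ep.deriv f) x := by
  have := trip_exact_right Ep Em hf x
  rw [trip_eq_zero_of_courant hb] at this
  linarith

theorem courant_swap (A B : GSection E M) (x : M) : courant B A x = -courant A B x := by
  have e : (fun y => A.form y (B.vec y) - B.form y (A.vec y)) =
      fun y => -(B.form y (A.vec y) - A.form y (B.vec y)) := by funext y; ring
  refine Prod.ext (VectorField.mlieBracket_swap_apply ..) ?_
  simp only [courant, dd, Prod.snd_neg]
  rw [e, mvfderiv_fun_neg, smul_neg]
  abel

theorem courant_eq_zero_symm (hb : ∀ x, courant Ep Em x = 0) (x : M) : courant Em Ep x = 0 := by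
  rw [courant_swap, hb, neg_zero]

/-- Involutivity of the `√-1`-eigenbundle, for the eigensections `Φ²A + √-1 ΦA`. -/
theorem inEigen_courantC_map (hΦ : IsGenAlmostContact Φ Ep Em)
    (hJ : IsGenComplexOn (perp Ep Em) Φ) (A B : GSection E M) (x : M) :
    InEigen (perp Ep Em) Φ x
      (courantC (map hΦ.smooth (map hΦ.smooth A), map hΦ.smooth A)
        (map hΦ.smooth (map hΦ.smooth B), map hΦ.smooth B) x) := by
  have h : ∀ (A : GSection E M) (x : M), InEigen (perp Ep Em) Φ x
      ((map hΦ.smooth (map hΦ.smooth A)).val x, (map hΦ.smooth A).val x) := fun A x =>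
    -- The image of Φ is orthogonal to E±, and Φ³ = -Φ is the eigenvector equation.
    ⟨⟨hΦ.pairing_left_map _, hΦ.symm.pairing_left_map _⟩,
      ⟨hΦ.pairing_left_map _, hΦ.symm.pairing_left_map _⟩, hΦ.cube _, rfl⟩
  exact hJ.involutive (_, _) (_, _) (h A) (h B) x

/-- The real part of the bracket of eigensections is orthogonal to E₊. -/
theorem trip_involutive_re (hΦ : IsGenAlmostContact Φ Ep Em)
    (hJ : IsGenComplexOn (perp Ep Em) Φ) (A B : GSection E M) (x : M) :
    trip (map hΦ.smooth (map hΦ.smooth A)) (map hΦ.smooth (map hΦ.smooth B)) Ep x =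
      trip (map hΦ.smooth A) (map hΦ.smooth B) Ep x := by
  have h := (inEigen_courantC_map hΦ hJ A B x).1.1
  simp only [courantC, pairing_sub_right] at h
  simp only [trip, pairing_comm _ (Ep.val x)]
  linarith

/-- The imaginary part of the same bracket is orthogonal to E₊. -/
theorem trip_involutive_im (hΦ : IsGenAlmostContact Φ Ep Em)
    (hJ : IsGenComplexOn (perp Ep Em) Φ) (A B : GSection E M) (x : M) :
    trip (map hΦ.smooth (map hΦ.smooth A)) (map hΦ.smooth B) Ep x
      + trip (map hΦ.smooth A) (map hΦ.smooth (map hΦ.smooth B)) Ep x = 0 := by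
  have h := (inEigen_courantC_map hΦ hJ A B x).2.1.1
  simp only [courantC, pairing_add_right] at h
  simp only [trip, pairing_comm _ (Ep.val x)]
  linarith

/-- The real part of the bracket is Φ of its imaginary part; skewness moves Φ onto C. -/
theorem trip_involutive_map (hΦ : IsGenAlmostContact Φ Ep Em)
    (hJ : IsGenComplexOn (perp Ep Em) Φ) (A B C : GSection E M) (x : M) :
    trip (map hΦ.smooth (map hΦ.smooth A)) (map hΦ.smooth (map hΦ.smooth B)) C x
      - trip (map hΦ.smooth A) (map hΦ.smooth B) C x =
    -(trip (map hΦ.smooth (map hΦ.smooth A)) (map hΦ.smooth B) (map hΦ.smooth C) x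
      + trip (map hΦ.smooth A) (map hΦ.smooth (map hΦ.smooth B)) (map hΦ.smooth C) x) := by
  have h := congrArg (pairing E (C.val x)) (inEigen_courantC_map hΦ hJ A B x).2.2.2
  have hs := hΦ.skew x (C.val x) (courantC (map hΦ.smooth (map hΦ.smooth A), map hΦ.smooth A)
        (map hΦ.smooth (map hΦ.smooth B), map hΦ.smooth B) x).2
  rw [h] at hs
  simp only [courantC, pairing_sub_right, pairing_add_right] at hs
  simp only [trip, pairing_comm _ (C.val x), val_map, pairing_comm _ (Φ x (C.val x))]
  linarith

/-- `e₊` is a derivation of the bracket `{f, g} = dg(Φ df)`. -/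
theorem deriv_left_bracket (hΦ : IsGenAlmostContact Φ Ep Em)
    (hJ : IsGenComplexOn (perp Ep Em) Φ) (hb : ∀ x, courant Ep Em x = 0) {f g : M → ℝ}
    (hf : SmoothFun E f) (hg : SmoothFun E g) (x : M) :
    Ep.deriv ((map hΦ.smooth (exact f hf)).deriv g) x =
      (map hΦ.smooth (exact f hf)).deriv (Ep.deriv g) x
        - (map hΦ.smooth (exact g hg)).deriv (Ep.deriv f) x := by
  -- After Φ² is expanded, each of the two terms contributes -½ e₊{f, g}; among the E± terms only
  -- those with ⟨E₋, E₊⟩ survive, giving {f, e₊g} and -{g, e₊f}.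
  have h := trip_involutive_im hΦ hJ (exact f hf) (exact g hg) x
  have hpp : ip Ep Ep x = 0 := by rw [ip, hΦ.pp, mul_zero]
  have hmp : ip Em Ep x = 1 := by rw [ip, pairing_comm, hΦ.pm]
  have hz1 : ∀ A : GSection E M, trip (map hΦ.smooth A) Ep Ep x = 0 := fun A => by
    rw [trip_antisymm, trip_left_map_left hΦ, neg_zero]
  have hz2 : ∀ A : GSection E M, trip (map hΦ.smooth A) Em Ep x = 0 := fun A => by
    rw [trip_antisymm, trip_left_map_right hΦ.symm (courant_eq_zero_symm hb), neg_zero]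
  rw [trip_antisymm, trip_map_map_exact hΦ hf, trip_map_map_exact hΦ hg, hz1, hz1, hz2, hz2,
    hpp, hmp, ip_map_left hΦ, ip_map_left hΦ.symm, ip_map_left hΦ, ip_map_left hΦ.symm,
    deriv_map_exact_swap hΦ hg hf, deriv_neg] at h
  linarith

/-- `2⟨[[Φ df, E₊]], Φ dh⟩` for functions `f`, `h`. -/
theorem trip_map_left_map (hΦ : IsGenAlmostContact Φ Ep Em)
    (hJ : IsGenComplexOn (perp Ep Em) Φ) (hb : ∀ x, courant Ep Em x = 0) {f h : M → ℝ}
    (hf : SmoothFun E f) (hh : SmoothFun E h) (x : M) :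
    trip (map hΦ.smooth (exact f hf)) Ep (map hΦ.smooth (exact h hh)) x =
      (map hΦ.smooth (map hΦ.smooth (exact h hh))).deriv (Ep.deriv f) x := by
  -- Expanding Φ² dh on the left of `hre` leaves only derivatives, which determines ⟨[[Φ df, Φ dh]],
  -- E₊⟩; `hm` then exchanges Φ dh and E₊ by metric compatibility.
  have hre := trip_involutive_re hΦ hJ (exact f hf) (exact h hh) x
  have hpp : ip Ep Ep x = 0 := by rw [ip, hΦ.pp, mul_zero]
  have hmp : ip Em Ep x = 1 := by rw [ip, pairing_comm, hΦ.pm]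
  have hz1 : ∀ A : GSection E M, trip (map hΦ.smooth A) Ep Ep x = 0 := fun A => by
    rw [trip_antisymm, trip_left_map_left hΦ, neg_zero]
  have hz2 : ∀ A : GSection E M, trip (map hΦ.smooth A) Em Ep x = 0 := fun A => by
    rw [trip_antisymm, trip_left_map_right hΦ.symm (courant_eq_zero_symm hb), neg_zero]
  have hm := deriv_ip (map hΦ.smooth (exact f hf)) (map hΦ.smooth (exact h hh)) Ep x
  have hFF : ip (map hΦ.smooth (exact f hf)) (map hΦ.smooth (exact h hh)) =
      fun y => -(Em.deriv h y * Ep.deriv f y + Ep.deriv h y * Em.deriv f y) := by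
    funext y
    rw [ip_map_map hΦ, ip_comm, ip_exact_right, deriv_map_map_exact hΦ]
  rw [trip_map_map_exact hΦ hh, hz1, hz2, hpp, hmp, ip_map_left hΦ, ip_map_left hΦ.symm,
    deriv_map_map_exact hΦ hf, deriv_map_map_exact hΦ hf, deriv_map_map_exact hΦ hf,
    deriv_mul_add_mul _ (Em.smooth_deriv hf) (Ep.smooth_deriv hh) (Ep.smooth_deriv hf)
      (Em.smooth_deriv hh)] at hre
  rw [hFF, deriv_neg, ip_map_left hΦ, ip_map_left hΦ, deriv_const, deriv_const,
    deriv_mul_add_mul _ (Em.smooth_deriv hh) (Ep.smooth_deriv hf) (Ep.smooth_deriv hh)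
      (Em.smooth_deriv hf)] at hm
  rw [deriv_map_map_exact hΦ hh]
  have c1 := deriv_comm hb hf x
  have c2 := deriv_comm hb hh x
  simp only at hre hm ⊢
  linear_combination hre - hm + Ep.deriv h x * c1 + Ep.deriv f x * c2

/-- The Jacobi identity for the bracket `{f, g} = dg(Φ df)`. -/
theorem jacobi_map (hΦ : IsGenAlmostContact Φ Ep Em)
    (hJ : IsGenComplexOn (perp Ep Em) Φ) (hb : ∀ x, courant Ep Em x = 0) {f g h : M → ℝ}
    (hf : SmoothFun E f) (hg : SmoothFun E g) (hh : SmoothFun E h) (x : M) :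
    (map hΦ.smooth (exact f hf)).deriv ((map hΦ.smooth (exact g hg)).deriv h) x
      + (map hΦ.smooth (exact g hg)).deriv ((map hΦ.smooth (exact h hh)).deriv f) x
      + (map hΦ.smooth (exact h hh)).deriv ((map hΦ.smooth (exact f hf)).deriv g) x = 0 := by
  have hi := trip_involutive_map hΦ hJ (exact f hf) (exact g hg) (exact h hh) x
  have hJ' : IsGenComplexOn (perp Em Ep) Φ := perp_comm Ep Em ▸ hJ
  have k := fun {f : M → ℝ} (hf : SmoothFun E f) => trip_map_left_map hΦ hJ hb hf hh x
  have k' := fun {f : M → ℝ} (hf : SmoothFun E f) =>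
    trip_map_left_map hΦ.symm hJ' (courant_eq_zero_symm hb) hf hh x
  -- Pairing with dh sees only commutators of vector fields. On the other side each Φ² contributes
  -- half of {h, {f, g}}, and `k`, `k'` evaluate the brackets with E±.
  rw [trip_antisymm (map hΦ.smooth (map hΦ.smooth (exact f hf))) (map hΦ.smooth (exact g hg)),
    trip_exact_right, trip_exact_right, trip_map_map_exact hΦ hf, trip_map_map_exact hΦ hg,
    k, k, k', k', ip_left_map hΦ, ip_left_map hΦ.symm, ip_map_left hΦ, ip_map_left hΦ,
    ip_map_left hΦ.symm, ip_map_left hΦ.symm, deriv_map_exact_swap hΦ hg hf, deriv_neg] at hi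
  simp only [deriv_map_map_exact hΦ,
    deriv_mul_add_mul _ (Em.smooth_deriv hf) (Ep.smooth_deriv hh) (Ep.smooth_deriv hf)
      (Em.smooth_deriv hh),
    deriv_mul_add_mul _ (Em.smooth_deriv hg) (Ep.smooth_deriv hh) (Ep.smooth_deriv hg)
      (Em.smooth_deriv hh)] at hi
  rw [deriv_map_exact_swap hΦ hh hf, deriv_neg]
  have cf := deriv_comm hb hf x
  have cg := deriv_comm hb hg x
  have ch := deriv_comm hb hh x
  -- Once e₊ and e₋ commute, all terms involving e± cancel.
  rw [cf, cg, ch] at hi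
  linear_combination -hi

/-! ### The Jacobi identity for π₀ + e₊ ∧ e₋ -/

/-- If `[[E₊, E₋]] = 0`, the bivector `π₀ + e₊ ∧ e₋` is Poisson. -/
theorem isPoisson_add_wedge (hΦ : IsGenAlmostContact Φ Ep Em)
    (hcomplex : IsGenComplexOn (perp Ep Em) Φ)
    (hbracket : ∀ x, courant Ep Em x = 0) :
    IsPoisson (canonicalBivector Φ + wedge Ep.vec Em.vec) := by
  refine ⟨fun x α => ?_, fun α β hα hβ => ?_, fun f g h hf hg hh x => ?_⟩
  · have hs := hΦ.skew x (0, α) (0, α)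
    simp only [pairing, map_zero] at hs
    change α (Φ x (0, α)).1 + (α (Ep.vec x) * α (Em.vec x) - α (Em.vec x) * α (Ep.vec x)) = 0
    linarith
  · have h := hΦ.smooth ⟨fun _ => 0, α, SmoothVec.zero, hα⟩
    exact (hβ.apply h.1).add (((hα.apply Ep.smooth_vec).mul (hβ.apply Em.smooth_vec)).sub
      ((hα.apply Em.smooth_vec).mul (hβ.apply Ep.smooth_vec)))
  · have hJ' : IsGenComplexOn (perp Em Ep) Φ := perp_comm Ep Em ▸ hcomplex
    have hb' := courant_eq_zero_symm hbracket
    have hp := fun {f g : M → ℝ} (hf : SmoothFun E f) (hg : SmoothFun E g) =>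
      deriv_left_bracket hΦ hcomplex hbracket hf hg x
    have hm := fun {f g : M → ℝ} (hf : SmoothFun E f) (hg : SmoothFun E g) =>
      deriv_left_bracket hΦ.symm hJ' hb' hf hg x
    simp only [poissonBracket_eq hΦ hf, poissonBracket_eq hΦ hg, poissonBracket_eq hΦ hh,
      deriv_bracket _ _ hf hg, deriv_bracket _ _ hg hh, deriv_bracket _ _ hh hf]
    -- The derivation property cancels the terms mixing π₀ with e₊ ∧ e₋, commutation those quadratic
    -- in e₊ ∧ e₋; the Jacobi sum of π₀ remains.
    rw [hp hf hg, hp hg hh, hp hh hf, hm hf hg, hm hg hh, hm hh hf, deriv_comm hbracket hf,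
      deriv_comm hbracket hg, deriv_comm hbracket hh]
    linear_combination jacobi_map hΦ hcomplex hbracket hf hg hh x

end GSection
end GenGeom

theorem lemma3p1 {E : Type*} [NormedAddCommGroup E] [NormedSpace ℝ E] [FiniteDimensional ℝ E]
    {M : Type*} [TopologicalSpace M] [ChartedSpace E M] [IsManifold 𝓘(ℝ, E) ∞ M] [T2Space M]
    (Φ : Π x : M, GT E x →ₗ[ℝ] GT E x) (Ep Em : GSection E M)
    (hΦ : IsGenAlmostContact Φ Ep Em)
    (hcomplex : IsGenComplexOn (perp Ep Em) Φ)
    (hbracket : ∀ x, courant Ep Em x = 0) :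
    IsPoisson (canonicalBivector Φ + wedge Ep.vec Em.vec) :=
  GSection.isPoisson_add_wedge hΦ hcomplex hbracket
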